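/- Let $-\infty\le a<b\le\infty$, let $w>0$ a.e. on $(a,b)$ with $w\in L^1_{\mathrm{loc}}(a,b)$, and let $\ell_0$ be a formally symmetric differential expression of order $2N$, $N\ge1$, $$\ell_0[f]=\frac1w\sum_{j=0}^{N}(-1)^j\bigl(a_jf^{(j)}\bigr)^{(j)},$$ with real coefficients such that $a_N\neq0$ a.e. and $1/a_N,a_0,\dots,a_{N-1}\in L^1_{\mathrm{loc}}(a,b)$; it is understood through its quasi-derivatives. (For $N=1$, $a_1=p$, $a_0=-q$ this is the Sturm–Liouville expression $-\frac1w\left((pf')'+qf\right)$.) Let $\ell=\ell_0^n$, $n\ge1$, be the $n$-fold composition. In the Hilbert space $L^2[(a,b),w]$ let $\mathcal D_{\max}$ be the set of all $f\in L^2[(a,b),w]$ such that all quasi-derivatives of order less than $2N$ of $f,\ell_0[f],\dots,\ell_0^{n-1}[f]$ are locally absolutely continuous on $(a,b)$ and $\ell[f]\in L^2[(a,b),w]$. For $f,g\in\mathcal D_{\max}$ put $$[f,g]\Big|_a^b=\lim_{\alpha\to a^+,\ \beta\to b^-}\int_\alpha^\beta\bigl\{\ell[f]\,\overline g-\overline{\ell[g]}\,f\bigr\}\,w\,dx,$$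 $$\mathcal D_{\min}=\bigl\{f\in\mathcal D_{\max}:[f,g]\big|_a^b=0\ \text{ for all } g\in\mathcal D_{\max}\bigr\},$$ and let $\mathbf L_{\max}=\{\ell,\mathcal D_{\max}\}$ and $\mathbf L_{\min}=\{\ell,\mathcal D_{\min}\}$ be the operators given by $\ell$ on these domains. Assume that $\mathbf L_{\min}$ has deficiency indices $(m,m)$, that is, $\dim\{f:\mathbf L_{\min}^*f=if\}=\dim\{f:\mathbf L_{\min}^*f=-if\}=m<\infty$. Let $\mathbf L$ be a self-adjoint operator in $L^2[(a,b),w]$ with domain $\mathcal D_{\mathbf L}$ and $\mathbf L_{\min}\subseteq\mathbf L\subseteq\mathbf L_{\max}$; for example, an operator $\mathbf L=\mathbf A^n$ from left-definite theory, where $\mathbf A$ is a self-adjoint operator acting by $\ell_0$ that is bounded below by a positive constant. Suppose that $\mathcal D_{\mathbf L}$ contains a sequence $\{P_k\}_{k=0}^\infty$ of non-zero, pairwise orthogonal eigenfunctions of $\mathbf L$ whose span is dense in $L^2[(a,b),w]$. Then there are $m$ distinct indices $k_1,\dots,k_m$ such that $P_{k_1},\dots,P_{k_m}$ are linearly independent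 modulo $\mathcal D_{\min}$ (no non-trivial linear combination of them lies in $\mathcal D_{\min}$), satisfy the Glazman symmetry conditions $[P_{k_i},P_{k_j}]\big|_a^b=0$ for $1\le i,j\le m$, and $$\mathcal D_{\mathbf L}=\bigl\{f\in\mathcal D_{\max}:[f,P_{k_i}]\big|_a^b=0,\ i=1,\dots,m\bigr\}.$$ -/

import Mathlib

open MeasureTheory Filter Topology

namespace GKN

/-- The real points of the open interval `(a, b)`, whose endpoints may be infinite. -/
def interval (a b : EReal) : Set ℝ := {x : ℝ | a < (x : EReal) ∧ (x : EReal) < b}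

/-- `f` belongs to `AC_loc(a, b)`: it is absolutely continuous on every compact subinterval. -/
def LocAbsCont (a b : EReal) (f : ℝ → ℂ) : Prop :=
  ∀ c ∈ interval a b, ∀ d ∈ interval a b, AbsolutelyContinuousOnInterval f c d

/-- The data of a formally symmetric differential expression of order `2 N` on `(a, b)` in
Lagrangian form, with weight `w` and real coefficients `a_0, …, a_N`,
`ℓ f = (1 / w) ∑_{j ≤ N} (-1)^j (a_j f^{(j)})^{(j)}`.
For `N = 1`, `a_1 = p` and `a_0 = -q` it is the Sturm-Liouville expression
`ℓ f = -(1 / w) ((p f')' + q f)`. Only the coefficients with index at most `N` matter. -/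
structure SymmExpr (N : ℕ) where
  a : EReal
  b : EReal
  coeff : ℕ → ℝ → ℝ
  w : ℝ → ℝ
  a_lt_b : a < b
  lead_ne_zero : ∀ᵐ x ∂(volume.restrict (interval a b)), coeff N x ≠ 0
  inv_lead_locallyIntegrable : LocallyIntegrableOn (fun x => (coeff N x)⁻¹) (interval a b)
  coeff_locallyIntegrable : ∀ j < N, LocallyIntegrableOn (coeff j) (interval a b)
  w_pos : ∀ᵐ x ∂(volume.restrict (interval a b)), 0 < w x
  w_locallyIntegrable : LocallyIntegrableOn w (interval a b)

namespace SymmExpr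

variable {N : ℕ} (τ : SymmExpr N)

/-- Lebesgue measure on `(a, b)`. -/
noncomputable abbrev leb : Measure ℝ := volume.restrict (interval τ.a τ.b)

/-- The measure `w(x) dx` on `(a, b)`. -/
noncomputable def weightMeasure : Measure ℝ :=
  τ.leb.withDensity fun x => ENNReal.ofReal (τ.w x)

/-- The Hilbert space `L²[(a, b), w]`. -/
abbrev Space : Type := Lp ℂ 2 τ.weightMeasure

/-- The derivative of the `k`-th quasi-derivative in terms of the list `φ` of quasi-derivatives
`φ 0 = f, …, φ (2 N - 1)` and of `φ (2 N) = w * ℓ f`. For smooth coefficients, `φ k = f^{(k)}` for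
`k < N`, `φ N = a_N f^{(N)}` and `φ (N + j) = a_{N-j} f^{(N-j)} - (φ (N + j - 1))'`. -/
noncomputable def quasiDeriv (φ : ℕ → ℝ → ℂ) (k : ℕ) (x : ℝ) : ℂ :=
  if k + 1 < N then φ (k + 1) x
  else if k + 1 = N then φ N x / (τ.coeff N x : ℂ)
  else (τ.coeff (2 * N - 1 - k) x : ℂ) * φ (2 * N - 1 - k) x - φ (k + 1) x

/-- `f` and its quasi-derivatives of order less than `2 N` are in `AC_loc(a, b)` (after a change of
`f` on a null set), and `ℓ f = g` almost everywhere on `(a, b)`. -/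
def Applies (f g : ℝ → ℂ) : Prop :=
  ∃ φ : ℕ → ℝ → ℂ,
    φ 0 =ᵐ[τ.leb] f ∧
    (∀ k < 2 * N, LocAbsCont τ.a τ.b (φ k)) ∧
    (∀ k < 2 * N, ∀ᵐ x ∂τ.leb, HasDerivAt (φ k) (τ.quasiDeriv φ k x) x) ∧
    φ (2 * N) =ᵐ[τ.leb] fun x => (τ.w x : ℂ) * g x

/-- `ℓ^n f = g`, where `ℓ^n` is `ℓ` composed with itself `n` times. All quasi-derivatives of
`f, ℓ f, …, ℓ^{n-1} f` of order less than `2 N` are in `AC_loc(a, b)`. -/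
def AppliesPow : ℕ → (ℝ → ℂ) → (ℝ → ℂ) → Prop
  | 0, f, g => f =ᵐ[τ.leb] g
  | n + 1, f, g => ∃ h, τ.Applies f h ∧ AppliesPow n h g

variable {τ}

theorem quasiDeriv_add (φ ψ : ℕ → ℝ → ℂ) (k : ℕ) (x : ℝ) :
    τ.quasiDeriv (fun j y => φ j y + ψ j y) k x = τ.quasiDeriv φ k x + τ.quasiDeriv ψ k x := by
  unfold quasiDeriv; split_ifs <;> ring

theorem quasiDeriv_smul (c : ℂ) (φ : ℕ → ℝ → ℂ) (k : ℕ) (x : ℝ) :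
    τ.quasiDeriv (fun j y => c * φ j y) k x = c * τ.quasiDeriv φ k x := by
  unfold quasiDeriv; split_ifs <;> ring

theorem Applies.add {f g f' g' : ℝ → ℂ} (h : τ.Applies f g) (h' : τ.Applies f' g') :
    τ.Applies (f + f') (g + g') := by
  obtain ⟨φ, h0, hac, hd, hw⟩ := h
  obtain ⟨ψ, h0', hac', hd', hw'⟩ := h'
  refine ⟨fun j y => φ j y + ψ j y, ?_, ?_, ?_, ?_⟩
  · filter_upwards [h0, h0'] with x hx hx'
    simp [hx, hx']
  · intro k hk c hc d hd
    exact (hac k hk c hc d hd).add (hac' k hk c hc d hd)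
  · intro k hk
    filter_upwards [hd k hk, hd' k hk] with x hx hx'
    rw [quasiDeriv_add]
    exact hx.add hx'
  · filter_upwards [hw, hw'] with x hx hx'
    simp [hx, hx', mul_add]

theorem Applies.smul {f g : ℝ → ℂ} (c : ℂ) (h : τ.Applies f g) : τ.Applies (c • f) (c • g) := by
  obtain ⟨φ, h0, hac, hd, hw⟩ := h
  refine ⟨fun j y => c * φ j y, ?_, ?_, ?_, ?_⟩
  · filter_upwards [h0] with x hx
    simp [hx]
  · intro k hk s hs t ht
    exact (hac k hk s hs t ht).const_smul c
  · intro k hk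
    filter_upwards [hd k hk] with x hx
    rw [quasiDeriv_smul]
    exact hx.const_mul c
  · filter_upwards [hw] with x hx
    simp only [hx, Pi.smul_apply, smul_eq_mul]
    ring

theorem Applies.congr {f g f' g' : ℝ → ℂ} (h : τ.Applies f g) (hf : f =ᵐ[τ.leb] f')
    (hg : g =ᵐ[τ.leb] g') : τ.Applies f' g' := by
  obtain ⟨φ, h0, hac, hd, hw⟩ := h
  refine ⟨φ, h0.trans hf, hac, hd, ?_⟩
  filter_upwards [hw, hg] with x hx hx'
  rw [hx, hx']

theorem isOpen_interval (a b : EReal) : IsOpen (interval a b) :=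
  (isOpen_lt continuous_const continuous_coe_real_ereal).inter
    (isOpen_lt continuous_coe_real_ereal continuous_const)

theorem LocAbsCont.eqOn_zero {a b : EReal} {f : ℝ → ℂ} (hf : LocAbsCont a b f)
    (h : f =ᵐ[volume.restrict (interval a b)] 0) : Set.EqOn f 0 (interval a b) := by
  have hc : ContinuousOn f (interval a b) := by
    intro x hx
    obtain ⟨ε, hε, hball⟩ := Metric.isOpen_iff.1 (isOpen_interval a b) x hx
    have hm : x - ε / 2 ∈ interval a b := hball (by
      rw [Metric.mem_ball, Real.dist_eq, abs_lt]; constructor <;> linarith)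
    have hp : x + ε / 2 ∈ interval a b := hball (by
      rw [Metric.mem_ball, Real.dist_eq, abs_lt]; constructor <;> linarith)
    have h1 := (hf _ hm _ hp).continuousOn
    rw [Set.uIcc_of_le (by linarith)] at h1
    exact (h1.continuousAt (Icc_mem_nhds (by linarith) (by linarith))).continuousWithinAt
  exact Measure.eqOn_open_of_ae_eq h (isOpen_interval a b) hc continuousOn_const

theorem Applies.ae_zero {f g : ℝ → ℂ} (h : τ.Applies f g)
    (hf : f =ᵐ[τ.leb] 0) : g =ᵐ[τ.leb] 0 := by
  obtain ⟨φ, h0, hac, hd, hw⟩ := h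
  have hI : MeasurableSet (interval τ.a τ.b) := (isOpen_interval _ _).measurableSet
  have hmem : ∀ᵐ x ∂τ.leb, x ∈ interval τ.a τ.b := ae_restrict_mem hI
  have key : ∀ k ≤ 2 * N, ∀ j ≤ k, φ j =ᵐ[τ.leb] 0 := by
    intro k
    induction k with
    | zero =>
      intro _ j hj
      obtain rfl : j = 0 := by omega
      exact h0.trans hf
    | succ k ih =>
      intro hk j hj
      have ih' := ih (by omega)
      rcases Nat.lt_or_ge j (k + 1) with hlt | hge
      · exact ih' j (by omega)
      obtain rfl : j = k + 1 := by omega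
      have hz := LocAbsCont.eqOn_zero (hac k (by omega)) (ih' k le_rfl)
      have hder : ∀ᵐ x ∂τ.leb, τ.quasiDeriv φ k x = 0 := by
        filter_upwards [hd k (by omega), hmem] with x hx hxI
        have : HasDerivAt (φ k) 0 x :=
          (hasDerivAt_const x (0 : ℂ)).congr_of_eventuallyEq
            (hz.eventuallyEq_of_mem ((isOpen_interval _ _).mem_nhds hxI))
        exact hx.unique this
      unfold quasiDeriv at hder
      split_ifs at hder with h1 h2
      · exact hder
      · filter_upwards [hder, τ.lead_ne_zero] with x hx hx'
        rw [h2]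
        simpa [hx'] using hx
      · filter_upwards [hder, ih' (2 * N - 1 - k) (by omega)] with x hx hx'
        rw [hx'] at hx
        simpa using hx
  filter_upwards [key (2 * N) le_rfl (2 * N) le_rfl, hw, τ.w_pos] with x h1 h2 h3
  rw [h1] at h2
  have h4 : (τ.w x : ℂ) ≠ 0 := by exact_mod_cast h3.ne'
  simpa [h4] using h2.symm

theorem AppliesPow.add {n : ℕ} {f g f' g' : ℝ → ℂ} (h : τ.AppliesPow n f g)
    (h' : τ.AppliesPow n f' g') : τ.AppliesPow n (f + f') (g + g') := by
  induction n generalizing f f' with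
  | zero => exact EventuallyEq.add h h'
  | succ n ih =>
    obtain ⟨u, hu, hu'⟩ := h
    obtain ⟨v, hv, hv'⟩ := h'
    exact ⟨u + v, hu.add hv, ih hu' hv'⟩

theorem AppliesPow.smul {n : ℕ} {f g : ℝ → ℂ} (c : ℂ) (h : τ.AppliesPow n f g) :
    τ.AppliesPow n (c • f) (c • g) := by
  induction n generalizing f with
  | zero => exact EventuallyEq.const_smul h c
  | succ n ih =>
    obtain ⟨u, hu, hu'⟩ := h
    exact ⟨c • u, hu.smul c, ih hu'⟩

theorem AppliesPow.ae_zero {n : ℕ} {f g : ℝ → ℂ} (h : τ.AppliesPow n f g)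
    (hf : f =ᵐ[τ.leb] 0) : g =ᵐ[τ.leb] 0 := by
  induction n generalizing f with
  | zero => exact (EventuallyEq.symm h).trans hf
  | succ n ih =>
    obtain ⟨u, hu, hu'⟩ := h
    exact ih hu' (hu.ae_zero hf)

theorem AppliesPow.congr {n : ℕ} {f g f' g' : ℝ → ℂ} (h : τ.AppliesPow n f g)
    (hf : f =ᵐ[τ.leb] f') (hg : g =ᵐ[τ.leb] g') : τ.AppliesPow n f' g' := by
  induction n generalizing f f' with
  | zero => exact (hf.symm.trans h).trans hg
  | succ n ih =>
    obtain ⟨u, hu, hu'⟩ := h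
    exact ⟨u, hu.congr hf EventuallyEq.rfl, ih hu' EventuallyEq.rfl⟩

theorem leb_absolutelyContinuous : τ.leb ≪ τ.weightMeasure := by
  refine withDensity_absolutelyContinuous' ?_ ?_
  · have hw : AEStronglyMeasurable τ.w τ.leb := τ.w_locallyIntegrable.aestronglyMeasurable
    exact hw.aemeasurable.ennreal_ofReal
  · filter_upwards [τ.w_pos] with x hx
    simpa using hx

variable (τ) (n : ℕ)

/-- The graph of the maximal operator of `ℓ^n`: all pairs `(f, ℓ^n f)` such that `f` and `ℓ^n f` lie
in `L²[(a, b), w]`. -/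
noncomputable def maxGraph : Submodule ℂ (τ.Space × τ.Space) where
  carrier := {z | τ.AppliesPow n z.1 z.2}
  zero_mem' := by
    have h0 : ∀ m, τ.AppliesPow m 0 0 := by
      intro m
      induction m with
      | zero => exact EventuallyEq.rfl
      | succ m ih =>
        refine ⟨0, ⟨0, EventuallyEq.rfl, ?_, ?_, ?_⟩, ih⟩
        · intro k _ c _ d _
          simpa [AbsolutelyContinuousOnInterval] using tendsto_const_nhds
        · intro k _
          refine Eventually.of_forall fun x => ?_
          have : τ.quasiDeriv 0 k x = 0 := by unfold quasiDeriv; split_ifs <;> simp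
          rw [this]
          exact hasDerivAt_const x (0 : ℂ)
        · exact Eventually.of_forall fun x => by simp
    exact (h0 n).congr (leb_absolutelyContinuous.ae_eq (Lp.coeFn_zero ℂ 2 _)).symm
      (leb_absolutelyContinuous.ae_eq (Lp.coeFn_zero ℂ 2 _)).symm
  add_mem' {z z'} hz hz' :=
    (AppliesPow.add hz hz').congr (leb_absolutelyContinuous.ae_eq (Lp.coeFn_add z.1 z'.1)).symm
      (leb_absolutelyContinuous.ae_eq (Lp.coeFn_add z.2 z'.2)).symm
  smul_mem' c z hz :=
    (AppliesPow.smul c hz).congr (leb_absolutelyContinuous.ae_eq (Lp.coeFn_smul c z.1)).symm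
      (leb_absolutelyContinuous.ae_eq (Lp.coeFn_smul c z.2)).symm

/-- The maximal operator `{ℓ^n, 𝒟_max}` in `L²[(a, b), w]`. -/
noncomputable def maxOp : τ.Space →ₗ.[ℂ] τ.Space := (τ.maxGraph n).toLinearPMap

/-- The junk value in the passage from a graph to an operator is never used. -/
theorem maxOp_graph : (τ.maxGraph n).toLinearPMap.graph = τ.maxGraph n := by
  refine Submodule.toLinearPMap_graph_eq _ fun z hz hz0 => ?_
  have h1 : (z.1 : ℝ → ℂ) =ᵐ[τ.leb] 0 := by
    rw [hz0]
    exact leb_absolutelyContinuous.ae_eq (Lp.coeFn_zero ℂ 2 _)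
  have h2 := AppliesPow.ae_zero hz h1
  refine (Lp.eq_zero_iff_ae_eq_zero).2 ?_
  exact (withDensity_absolutelyContinuous _ _).ae_eq h2

variable {τ n}

theorem mem_maxOp_graph {u v : τ.Space} :
    (u, v) ∈ (τ.maxOp n).graph ↔ τ.AppliesPow n u v := by
  rw [maxOp, maxOp_graph]
  rfl

/-- The sesquilinear form on a subinterval, given by Green's formula:
`[f, g]_n |_α^β = ∫_α^β (ℓ^n[f] conj(g) - conj(ℓ^n[g]) f) w dx`. -/
noncomputable def greenForm (f g : (τ.maxOp n).domain) (α β : ℝ) : ℂ :=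
  ∫ x in α..β, ((τ.maxOp n f : τ.Space) x * (starRingEnd ℂ) ((g : τ.Space) x)
    - (starRingEnd ℂ) ((τ.maxOp n g : τ.Space) x) * (f : τ.Space) x) ∂τ.weightMeasure

/-- `[f, g]_n |_a^b = c`, i.e. `[f, g]_n |_α^β → c` as `α → a+` and `β → b-`. -/
def HasBoundaryForm (f g : (τ.maxOp n).domain) (c : ℂ) : Prop :=
  Tendsto (fun t : ℝ × ℝ => greenForm f g t.1 t.2)
    (comap Real.toEReal (𝓝[>] τ.a) ×ˢ comap Real.toEReal (𝓝[<] τ.b)) (𝓝 c)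

theorem integrable_mul_conj (u v : τ.Space) :
    Integrable (fun x => u x * (starRingEnd ℂ) (v x)) τ.weightMeasure :=
  L2.integrable_inner (𝕜 := ℂ) v u

theorem integrable_green (f g : (τ.maxOp n).domain) :
    Integrable (fun x => (τ.maxOp n f : τ.Space) x * (starRingEnd ℂ) ((g : τ.Space) x)
      - (starRingEnd ℂ) ((τ.maxOp n g : τ.Space) x) * (f : τ.Space) x) τ.weightMeasure := by
  refine (integrable_mul_conj _ _).sub ?_
  simpa only [mul_comm] using integrable_mul_conj (f : τ.Space) (τ.maxOp n g)

theorem greenForm_add (f f' g : (τ.maxOp n).domain) (α β : ℝ) :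
    greenForm (f + f') g α β = greenForm f g α β + greenForm f' g α β := by
  unfold greenForm
  rw [← intervalIntegral.integral_add (integrable_green f g).intervalIntegrable
    (integrable_green f' g).intervalIntegrable]
  refine intervalIntegral.integral_congr_ae ?_
  have h1 := Lp.coeFn_add (f : τ.Space) f'
  have h2 := Lp.coeFn_add (τ.maxOp n f) (τ.maxOp n f')
  filter_upwards [h1, h2] with x hx hx' _
  rw [LinearPMap.map_add, Submodule.coe_add, hx, hx']
  simp only [Pi.add_apply]
  ring

theorem greenForm_smul (c : ℂ) (f g : (τ.maxOp n).domain) (α β : ℝ) :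
    greenForm (c • f) g α β = c * greenForm f g α β := by
  unfold greenForm
  rw [← intervalIntegral.integral_const_mul]
  refine intervalIntegral.integral_congr_ae ?_
  have h1 := Lp.coeFn_smul c (f : τ.Space)
  have h2 := Lp.coeFn_smul c (τ.maxOp n f)
  filter_upwards [h1, h2] with x hx hx' _
  rw [LinearPMap.map_smul, Submodule.coe_smul, hx, hx']
  simp only [Pi.smul_apply, smul_eq_mul]
  ring

variable (τ n)

/-- The minimal domain
`𝒟_min = {f ∈ 𝒟_max | [f, g]_n |_a^b = 0 for all g ∈ 𝒟_max}`. -/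
noncomputable def minDomain : Submodule ℂ τ.Space :=
  Submodule.map (τ.maxOp n).domain.subtype
    { carrier := {f | ∀ g, HasBoundaryForm f g 0}
      zero_mem' := fun g => by
        have h : ∀ α β, greenForm (0 : (τ.maxOp n).domain) g α β = 0 := fun α β => by
          simpa using greenForm_smul 0 (0 : (τ.maxOp n).domain) g α β
        simp only [HasBoundaryForm, h]
        exact tendsto_const_nhds
      add_mem' := fun {f f'} hf hf' g => by
        simpa only [HasBoundaryForm, greenForm_add, add_zero] using Tendsto.add (hf g) (hf' g)
      smul_mem' := fun c f hf g => by
        simpa only [HasBoundaryForm, greenForm_smul, mul_zero] using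
          Tendsto.const_mul c (hf g) }

/-- The minimal operator `{ℓ^n, 𝒟_min}`. -/
noncomputable def minOp : τ.Space →ₗ.[ℂ] τ.Space := (τ.maxOp n).domRestrict (τ.minDomain n)

end SymmExpr

/-- The space of all `f ∈ 𝒟(A*)` with `A* f = z f`; membership of `(f, z f)` in the graph of the
adjoint means `⟪A u, f⟫ = ⟪u, z f⟫` for all `u ∈ 𝒟(A)`. The positive and the negative defect space
of `A` are the cases `z = i` and `z = -i`. -/
noncomputable def defectSpace {H : Type*} [NormedAddCommGroup H] [InnerProductSpace ℂ H]
    (A : H →ₗ.[ℂ] H) (z : ℂ) : Submodule ℂ H :=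
  A.graph.adjoint.comap (LinearMap.prod LinearMap.id (z • LinearMap.id))

/-- For densely defined `A`, `defectSpace A z` is an eigenspace of the adjoint operator `A†`. -/
theorem mem_defectSpace_iff {H : Type*} [NormedAddCommGroup H] [InnerProductSpace ℂ H]
    [CompleteSpace H] {A : H →ₗ.[ℂ] H} (hA : Dense (A.domain : Set H)) {z : ℂ} {f : H} :
    f ∈ defectSpace A z ↔ ∃ h : f ∈ A.adjoint.domain, A.adjoint ⟨f, h⟩ = z • f := by
  simp [defectSpace, ← LinearPMap.adjoint_graph_eq_graph_adjoint hA, LinearPMap.mem_graph_iff]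

/-- `A` has deficiency indices `(m, m)`. -/
def HasDeficiencyIndices {H : Type*} [NormedAddCommGroup H] [InnerProductSpace ℂ H]
    (A : H →ₗ.[ℂ] H) (m : ℕ) : Prop :=
  Module.rank ℂ (defectSpace A Complex.I) = m ∧ Module.rank ℂ (defectSpace A (-Complex.I)) = m

/-- `x_1, …, x_r` are linearly independent modulo the subspace `X`. -/
def LinIndepModulo {V : Type*} [AddCommGroup V] [Module ℂ V] (X : Submodule ℂ V) {r : ℕ}
    (x : Fin r → V) : Prop :=
  ∀ c : Fin r → ℂ, ∑ i, c i • x i ∈ X → ∀ i, c i = 0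

end GKN

/-!
For a self-adjoint operator `L` the map `L - i : 𝒟(L) → H` is bijective and bounded below. It
carries the domain of a closed restriction `A` of `L` onto the orthogonal complement of a defect
space of `A`, so that `x ↦ proj (L x - i x)` identifies `𝒟(L) / 𝒟(A)` with that defect space, whose
dimension is `m`. A family whose span is a core of `L` (such as a complete family of eigenvectors)
has an image that is dense in, hence spans, this finite-dimensional quotient, and `m` of its members
form a basis of `𝒟(L)` modulo `𝒟(A)`.

Let `A` be the adjoint of a larger operator `M = L_max`; this is the minimal operator, and its
domain is the radical of the boundary form of `M`. A function `f` that satisfies the `m` boundary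
conditions is then orthogonal, with respect to the boundary form, to all of `𝒟(L)`, which says that
`f` lies in the domain of the adjoint of `L`, that is, of `L` itself.
-/

namespace GKN

section LinearAlgebra

theorem exists_fin_basis_of_span_range_eq_top {𝕜 V ι : Type*} [DivisionRing 𝕜] [AddCommGroup V]
    [Module 𝕜 V] {m : ℕ} (hm : Module.rank 𝕜 V = m) (v : ι → V)
    (hv : Submodule.span 𝕜 (Set.range v) = ⊤) :
    ∃ k : Fin m → ι, Function.Injective k ∧ LinearIndependent 𝕜 (v ∘ k) ∧
      Submodule.span 𝕜 (Set.range (v ∘ k)) = ⊤ := by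
  obtain ⟨κ, a, ha, hspan, hli⟩ := exists_linearIndependent' 𝕜 v
  rw [hv] at hspan
  let b := Module.Basis.mk hli hspan.ge
  have : Fintype κ := Module.Basis.fintypeIndexOfRankLtAleph0 b (hm ▸ Cardinal.natCast_lt_aleph0)
  have hcard : Fintype.card κ = m := by
    rw [← Module.finrank_eq_card_basis b, Module.finrank_eq_of_rank_eq hm]
  let e := (Fintype.equivFinOfCardEq hcard).symm
  refine ⟨a ∘ e, ha.comp e.injective, hli.comp e e.injective, ?_⟩
  rw [← Function.comp_assoc, e.surjective.range_comp, hspan]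

end LinearAlgebra

section Core

variable {R E F : Type*} [AddCommGroup E] [AddCommGroup F]

theorem mem_graph_iff_of_le [Ring R] [Module R E] [Module R F] {A L : E →ₗ.[R] F} (hAL : A ≤ L)
    {p : E × F} (hp : p ∈ L.graph) : p ∈ A.graph ↔ p.1 ∈ A.domain := by
  refine ⟨LinearPMap.mem_domain_of_mem_graph, fun hx => ?_⟩
  have hgraph := A.mem_graph ⟨p.1, hx⟩
  have hsnd : A ⟨p.1, hx⟩ = p.2 :=
    L.mem_graph_snd_inj (LinearPMap.le_graph_of_le hAL hgraph) hp rfl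
  rwa [hsnd] at hgraph

theorem graph_domRestrict_span_range [Ring R] [Module R E] [Module R F] {ι : Type*}
    (L : E →ₗ.[R] F) (P : ι → L.domain) :
    (L.domRestrict (Submodule.span R (Set.range fun k => (P k : E)))).graph =
      Submodule.span R (Set.range fun k => ((P k : E), L (P k))) := by
  set S := Submodule.span R (Set.range fun k => (P k : E))
  set G := Submodule.span R (Set.range fun k => ((P k : E), L (P k)))
  have hGL : G ≤ L.graph := Submodule.span_le.2 (by rintro _ ⟨k, rfl⟩; exact L.mem_graph (P k))
  have hGS : G.map (LinearMap.fst R E F) = S := by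
    rw [Submodule.map_span, ← Set.range_comp]; rfl
  have hrestrict : L.domRestrict S ≤ L := LinearPMap.domRestrict_le
  ext p
  constructor
  · intro hp
    have hpS : p.1 ∈ S := (LinearPMap.mem_domain_of_mem_graph hp).1
    rw [← hGS] at hpS
    obtain ⟨q, hq, hqp⟩ := hpS
    rwa [← Prod.ext hqp (L.mem_graph_snd_inj (hGL hq) (LinearPMap.le_graph_of_le hrestrict hp) hqp)]
  · intro hp
    have hpS : p.1 ∈ S := hGS ▸ Submodule.mem_map_of_mem hp
    exact (mem_graph_iff_of_le hrestrict (hGL hp)).2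
      ⟨hpS, LinearPMap.mem_domain_of_mem_graph (hGL hp)⟩

theorem hasCore_iff_graph_le_topologicalClosure [CommRing R] [Module R E] [Module R F]
    [TopologicalSpace R] [TopologicalSpace E] [ContinuousAdd E] [ContinuousSMul R E]
    [TopologicalSpace F] [ContinuousAdd F] [ContinuousSMul R F] {L : E →ₗ.[R] F} (hL : L.IsClosed)
    {S : Submodule R E} :
    L.HasCore S ↔ S ≤ L.domain ∧ L.graph ≤ (L.domRestrict S).graph.topologicalClosure := by
  have hrestrict : L.domRestrict S ≤ L := LinearPMap.domRestrict_le
  have hle : (L.domRestrict S).graph.topologicalClosure ≤ L.graph :=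
    Submodule.topologicalClosure_minimal _ (LinearPMap.le_graph_of_le hrestrict) hL
  have hclosure := (hL.isClosable.leIsClosable hrestrict).graph_closure_eq_closure_graph
  constructor
  · intro h
    exact ⟨h.le_domain, by rw [hclosure, h.closure_eq]⟩
  · intro h
    exact ⟨h.1, LinearPMap.eq_of_eq_graph (hclosure ▸ le_antisymm hle h.2)⟩

end Core

section FormalAdjoint

variable {𝕜 E F : Type*} [RCLike 𝕜] [NormedAddCommGroup E] [InnerProductSpace 𝕜 E]
  [NormedAddCommGroup F] [InnerProductSpace 𝕜 F] {T T' : E →ₗ.[𝕜] F} {S S' : F →ₗ.[𝕜] E}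

theorem isFormalAdjoint_of_le (h : T'.IsFormalAdjoint S') (hT : T ≤ T') (hS : S ≤ S') :
    T.IsFormalAdjoint S := fun x y => by
  rw [hT.2 (y := ⟨x, hT.1 x.2⟩) rfl, hS.2 (y := ⟨y, hS.1 y.2⟩) rfl]
  exact h ⟨x, hT.1 x.2⟩ ⟨y, hS.1 y.2⟩

theorem adjoint_le_adjoint_of_le [CompleteSpace E] (hT : Dense (T.domain : Set E)) (h : T ≤ T') :
    T'.adjoint ≤ T.adjoint := by
  have hT' : Dense (T'.domain : Set E) := hT.mono h.1
  have hformal := (LinearPMap.adjoint_isFormalAdjoint hT').symm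
  exact LinearPMap.IsFormalAdjoint.le_adjoint hT (isFormalAdjoint_of_le hformal h le_rfl)

end FormalAdjoint

variable {H : Type*} [NormedAddCommGroup H] [InnerProductSpace ℂ H] {A L M : H →ₗ.[ℂ] H} {z : ℂ}

section Shift

/-- The map `(x, y) ↦ y - z x`. On the graph of an operator `A` it plays the role of `A - z`,
without reference to the domain of `A`; it maps the graph onto the range of `A - z`. -/
noncomputable def shift (z : ℂ) : H × H →L[ℂ] H :=
  ContinuousLinearMap.snd ℂ H H - z • ContinuousLinearMap.fst ℂ H H

theorem shift_apply (z : ℂ) (p : H × H) : shift z p = p.2 - z • p.1 := rfl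

theorem defectSpace_eq_orthogonal_map_shift (A : H →ₗ.[ℂ] H) (z : ℂ) :
    defectSpace A z = (A.graph.map (shift (starRingEnd ℂ z)).toLinearMap)ᗮ := by
  ext v
  have hinner (p : H × H) :
      inner ℂ (shift (starRingEnd ℂ z) p) v = inner ℂ p.2 v - inner ℂ p.1 (z • v) := by
    rw [shift_apply, inner_sub_left, inner_smul_left, inner_smul_right, Complex.conj_conj]
  simp only [Submodule.mem_orthogonal, Submodule.mem_map, forall_exists_index, and_imp,
    forall_apply_eq_imp_iff₂, ContinuousLinearMap.coe_coe, hinner]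
  simp only [defectSpace, Submodule.mem_comap, Submodule.mem_adjoint_iff, LinearMap.prod_apply,
    Function.prod, LinearMap.id_apply, LinearMap.smul_apply, Prod.forall]

/-- The imaginary part of `⟪x, A x - z x⟫` is `-(im z) ‖x‖²`, as `⟪x, A x⟫` is real. -/
theorem abs_im_mul_norm_fst_le_norm_shift (hA : A.IsFormalAdjoint A) (z : ℂ) {p : H × H}
    (hp : p ∈ A.graph) : |z.im| * ‖p.1‖ ≤ ‖shift z p‖ := by
  obtain ⟨x, hx, hAx⟩ := (LinearPMap.mem_graph_iff A).1 hp
  have hreal : (inner ℂ p.1 p.2).im = 0 := by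
    rw [← Complex.conj_eq_iff_im, inner_conj_symm, ← hx, ← hAx, hA x x]
  have hself : inner ℂ p.1 p.1 = ((‖p.1‖ ^ 2 : ℝ) : ℂ) := mod_cast inner_self_eq_norm_sq_to_K p.1
  have him : (inner ℂ p.1 (shift z p)).im = -(z.im * ‖p.1‖ ^ 2) := by
    rw [shift_apply, inner_sub_right, inner_smul_right, hself, Complex.sub_im, hreal,
      Complex.im_mul_ofReal, zero_sub]
  rcases (norm_nonneg p.1).eq_or_lt' with h0 | hpos
  · simp [h0]
  refine le_of_mul_le_mul_left ?_ hpos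
  calc ‖p.1‖ * (|z.im| * ‖p.1‖) = |(inner ℂ p.1 (shift z p)).im| := by
        rw [him, abs_neg, abs_mul, abs_of_nonneg (sq_nonneg ‖p.1‖)]; ring
    _ ≤ ‖inner ℂ p.1 (shift z p)‖ := Complex.abs_im_le_norm _
    _ ≤ ‖p.1‖ * ‖shift z p‖ := norm_inner_le_norm _ _

theorem exists_norm_le_mul_norm_shift (hA : A.IsFormalAdjoint A) (hz : z.im ≠ 0) :
    ∃ C : NNReal, ∀ p ∈ A.graph, ‖p‖ ≤ C * ‖shift z p‖ := by
  refine ⟨⟨1 + (1 + ‖z‖) / |z.im|, by positivity⟩, fun p hp => ?_⟩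
  have hz' : 0 < |z.im| := abs_pos.2 hz
  have hfst : ‖p.1‖ ≤ ‖shift z p‖ / |z.im| :=
    (le_div_iff₀' hz').2 (abs_im_mul_norm_fst_le_norm_shift hA z hp)
  have hsnd : ‖p.2‖ ≤ ‖shift z p‖ + ‖z‖ * ‖p.1‖ := by
    rw [← norm_smul, shift_apply]
    simpa only [sub_add_cancel] using norm_add_le (p.2 - z • p.1) (z • p.1)
  have hsplit : (1 + (1 + ‖z‖) / |z.im|) * ‖shift z p‖ =
      ‖shift z p‖ + ‖shift z p‖ / |z.im| + ‖z‖ * (‖shift z p‖ / |z.im|) := by ring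
  have hmul := mul_le_mul_of_nonneg_left hfst (norm_nonneg z)
  have hnonneg := mul_nonneg (norm_nonneg z) ((norm_nonneg p.1).trans hfst)
  have hshift := norm_nonneg (shift z p)
  change ‖p‖ ≤ (1 + (1 + ‖z‖) / |z.im|) * ‖shift z p‖
  rw [hsplit]
  exact max_le (by linarith) (by linarith [(norm_nonneg p.1).trans hfst])

theorem exists_antilipschitzWith_shift (hA : A.IsFormalAdjoint A) (hz : z.im ≠ 0) :
    ∃ C, AntilipschitzWith C ((shift z).comp A.graph.subtypeL) := by
  obtain ⟨C, hC⟩ := exists_norm_le_mul_norm_shift hA hz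
  exact ⟨C, ContinuousLinearMap.antilipschitz_of_bound _ fun p => hC p p.2⟩

theorem shift_injOn_graph (hA : A.IsFormalAdjoint A) (hz : z.im ≠ 0) :
    Set.InjOn (shift z) (A.graph : Set (H × H)) := by
  obtain ⟨C, hC⟩ := exists_antilipschitzWith_shift hA hz
  exact Set.injOn_iff_injective.2 hC.injective

theorem graph_le_topologicalClosure_of_dense_map_shift (hA : A.IsFormalAdjoint A) (hz : z.im ≠ 0)
    {G : Submodule ℂ (H × H)} (hGA : G ≤ A.graph)
    (hG : Dense (G.map (shift z).toLinearMap : Set H)) : A.graph ≤ G.topologicalClosure := by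
  obtain ⟨C, hC⟩ := exists_antilipschitzWith_shift hA hz
  set T := (shift z).comp A.graph.subtypeL
  have himage : T '' (Subtype.val ⁻¹' (G : Set (H × H))) = G.map (shift z).toLinearMap := by
    rw [Submodule.map_coe, ContinuousLinearMap.coe_comp, Set.image_comp]
    exact congrArg _ (Set.image_preimage_eq_of_subset fun p hp => ⟨⟨p, hGA hp⟩, rfl⟩)
  have hdense : Dense (Subtype.val ⁻¹' (G : Set (H × H)) : Set A.graph) := by
    rw [(hC.isUniformInducing T.uniformContinuous).isInducing.dense_iff]
    exact fun p => himage ▸ hG (T p)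
  exact fun p hp => map_mem_closure continuous_subtype_val (hdense ⟨p, hp⟩) fun _ => id

theorem isClosed_map_shift_graph [CompleteSpace H] (hcl : A.IsClosed) (hA : A.IsFormalAdjoint A)
    (hz : z.im ≠ 0) : IsClosed (A.graph.map (shift z).toLinearMap : Set H) := by
  have : CompleteSpace A.graph := IsClosed.completeSpace_coe (hs := hcl)
  obtain ⟨C, hC⟩ := exists_antilipschitzWith_shift hA hz
  have h := hC.isClosed_range ((shift z).comp A.graph.subtypeL).uniformContinuous
  rwa [ContinuousLinearMap.coe_comp, Set.range_comp, Submodule.coe_subtypeL, Submodule.coe_subtype,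
    Subtype.range_coe] at h

theorem orthogonal_defectSpace [CompleteSpace H] (hcl : A.IsClosed) (hA : A.IsFormalAdjoint A)
    (hz : z.im ≠ 0) :
    (defectSpace A z)ᗮ = A.graph.map (shift (starRingEnd ℂ z)).toLinearMap := by
  have hz' : (starRingEnd ℂ z).im ≠ 0 := by rwa [Complex.conj_im, neg_ne_zero]
  rw [defectSpace_eq_orthogonal_map_shift, Submodule.orthogonal_orthogonal_eq_closure,
    (isClosed_map_shift_graph hcl hA hz').submodule_topologicalClosure_eq]

end Shift

section SelfAdjoint

variable [CompleteSpace H]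

theorem graph_adjoint_eq_graph_of_isSelfAdjoint (hL : IsSelfAdjoint L) :
    L.graph.adjoint = L.graph := by
  rw [← LinearPMap.adjoint_graph_eq_graph_adjoint hL.dense_domain,
    LinearPMap.isSelfAdjoint_def.1 hL]

theorem isFormalAdjoint_of_isSelfAdjoint (hL : IsSelfAdjoint L) : L.IsFormalAdjoint L := by
  have h := LinearPMap.adjoint_isFormalAdjoint hL.dense_domain
  rwa [LinearPMap.isSelfAdjoint_def.1 hL] at h

theorem defectSpace_eq_bot_of_isSelfAdjoint (hL : IsSelfAdjoint L) (hz : z.im ≠ 0) :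
    defectSpace L z = ⊥ := by
  refine (Submodule.eq_bot_iff _).2 fun v hv => ?_
  have hvL : (v, z • v) ∈ L.graph := by
    rw [← graph_adjoint_eq_graph_of_isSelfAdjoint hL]; exact hv
  have hbound := abs_im_mul_norm_fst_le_norm_shift (isFormalAdjoint_of_isSelfAdjoint hL) z hvL
  rw [shift_apply, sub_self, norm_zero] at hbound
  exact norm_le_zero_iff.1 (nonpos_of_mul_nonpos_right hbound (abs_pos.2 hz))

theorem map_shift_graph_eq_top (hL : IsSelfAdjoint L) (hz : z.im ≠ 0) :
    L.graph.map (shift (starRingEnd ℂ z)).toLinearMap = ⊤ := by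
  rw [← orthogonal_defectSpace hL.isClosed (isFormalAdjoint_of_isSelfAdjoint hL) hz,
    defectSpace_eq_bot_of_isSelfAdjoint hL hz, Submodule.bot_orthogonal_eq_top]

theorem hasCore_span_eigenvectors {ι : Type*} (hL : IsSelfAdjoint L) (P : ι → L.domain)
    (hP0 : ∀ k, (P k : H) ≠ 0) (hPeig : ∀ k, ∃ lam : ℂ, L (P k) = lam • (P k : H))
    (hP : Dense (Submodule.span ℂ (Set.range fun k => (P k : H)) : Set H)) :
    L.HasCore (Submodule.span ℂ (Set.range fun k => (P k : H))) := by
  have hsym := isFormalAdjoint_of_isSelfAdjoint hL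
  have hI : Complex.I.im ≠ 0 := by simp
  refine (hasCore_iff_graph_le_topologicalClosure hL.isClosed).2 ⟨?_, ?_⟩
  · exact Submodule.span_le.2 (by rintro _ ⟨k, rfl⟩; exact (P k).2)
  rw [graph_domRestrict_span_range]
  refine graph_le_topologicalClosure_of_dense_map_shift hsym hI
    (Submodule.span_le.2 (by rintro _ ⟨k, rfl⟩; exact L.mem_graph (P k))) (hP.mono ?_)
  rw [Submodule.map_span, ← Set.range_comp]
  refine Submodule.span_le.2 ?_
  rintro _ ⟨k, rfl⟩
  obtain ⟨lam, hlam⟩ := hPeig k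
  have hshift : shift Complex.I ((P k : H), L (P k)) = (lam - Complex.I) • (P k : H) := by
    rw [shift_apply, hlam, sub_smul]
  have hne : lam - Complex.I ≠ 0 := by
    intro h0
    rw [h0, zero_smul, ← map_zero (shift Complex.I)] at hshift
    exact hP0 k (congrArg Prod.fst
      (shift_injOn_graph hsym hI (L.mem_graph (P k)) L.graph.zero_mem hshift))
  refine (Submodule.smul_mem_iff _ hne).1 (Submodule.subset_span ⟨k, ?_⟩)
  exact hshift

end SelfAdjoint

section DefectMap

variable [CompleteSpace H]

instance (A : H →ₗ.[ℂ] H) (z : ℂ) : CompleteSpace (defectSpace A z) := by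
  rw [defectSpace_eq_orthogonal_map_shift]
  infer_instance

/-- The map `(x, y) ↦ proj (y - z̄ x)` onto the defect space of `A` at `z`. On the graph of a
self-adjoint extension `L` of a closed operator `A` it is surjective and its kernel is the graph of
`A`, so that it identifies `𝒟(L) / 𝒟(A)` with the defect space. -/
noncomputable def defectMap (A : H →ₗ.[ℂ] H) (z : ℂ) : H × H →L[ℂ] defectSpace A z :=
  (defectSpace A z).orthogonalProjectionOnto ∘L shift (starRingEnd ℂ z)

theorem defectMap_eq_zero_iff (hL : IsSelfAdjoint L) (hAL : A ≤ L) (hA : A.IsClosed)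
    (hz : z.im ≠ 0) {p : H × H} (hp : p ∈ L.graph) : defectMap A z p = 0 ↔ p.1 ∈ A.domain := by
  have hsym := isFormalAdjoint_of_isSelfAdjoint hL
  have hz' : (starRingEnd ℂ z).im ≠ 0 := by rwa [Complex.conj_im, neg_ne_zero]
  rw [defectMap, ContinuousLinearMap.comp_apply, Submodule.orthogonalProjectionOnto_eq_zero_iff,
    orthogonal_defectSpace hA (isFormalAdjoint_of_le hsym hAL hAL) hz, ← mem_graph_iff_of_le hAL hp]
  refine ⟨?_, Submodule.mem_map_of_mem⟩
  rintro ⟨q, hq, hqp⟩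
  rwa [← shift_injOn_graph hsym hz' (LinearPMap.le_graph_of_le hAL hq) hp hqp]

theorem map_defectMap_graph_eq_top (A : H →ₗ.[ℂ] H) (hL : IsSelfAdjoint L) (hz : z.im ≠ 0) :
    L.graph.map (defectMap A z).toLinearMap = ⊤ := by
  rw [defectMap, ContinuousLinearMap.toLinearMap_comp, Submodule.map_comp,
    map_shift_graph_eq_top hL hz, Submodule.map_top, LinearMap.range_eq_top]
  exact fun v => ⟨v, (defectSpace A z).orthogonalProjectionOnto_mem_subspace_eq_self v⟩

theorem span_range_defectMap_eq_top {ι : Type*} (A : H →ₗ.[ℂ] H) (hL : IsSelfAdjoint L)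
    (hz : z.im ≠ 0) [FiniteDimensional ℂ (defectSpace A z)] (P : ι → L.domain)
    (hP : L.HasCore (Submodule.span ℂ (Set.range fun k => (P k : H)))) :
    Submodule.span ℂ (Set.range fun k => defectMap A z ((P k : H), L (P k))) = ⊤ := by
  have hcore := ((hasCore_iff_graph_le_topologicalClosure hL.isClosed).1 hP).2
  rw [graph_domRestrict_span_range] at hcore
  refine top_le_iff.1 ?_
  calc ⊤ = L.graph.map (defectMap A z).toLinearMap := (map_defectMap_graph_eq_top A hL hz).symm
    _ ≤ (Submodule.span ℂ (Set.range fun k => ((P k : H), L (P k)))).topologicalClosure.map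
          (defectMap A z).toLinearMap := Submodule.map_mono hcore
    _ ≤ ((Submodule.span ℂ (Set.range fun k => ((P k : H), L (P k)))).map
          (defectMap A z).toLinearMap).topologicalClosure := Submodule.topologicalClosure_map _ _
    _ = (Submodule.span ℂ (Set.range fun k => ((P k : H), L (P k)))).map
          (defectMap A z).toLinearMap :=
        (Submodule.closed_of_finiteDimensional _).submodule_topologicalClosure_eq
    _ = Submodule.span ℂ (Set.range fun k => defectMap A z ((P k : H), L (P k))) := by
        rw [Submodule.map_span, ← Set.range_comp]; rfl

theorem exists_fin_basis_modulo_of_hasCore {ι : Type*} (hL : IsSelfAdjoint L) (hAL : A ≤ L)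
    (hA : A.IsClosed) (hz : z.im ≠ 0) {m : ℕ} (hm : Module.rank ℂ (defectSpace A z) = m)
    (P : ι → L.domain) (hP : L.HasCore (Submodule.span ℂ (Set.range fun k => (P k : H)))) :
    ∃ k : Fin m → ι, Function.Injective k ∧
      LinIndepModulo A.domain (fun i => (P (k i) : H)) ∧
      L.domain ≤ A.domain ⊔ Submodule.span ℂ (Set.range fun i => (P (k i) : H)) := by
  have : FiniteDimensional ℂ (defectSpace A z) :=
    Module.rank_lt_aleph0_iff.1 (hm ▸ Cardinal.natCast_lt_aleph0)
  obtain ⟨k, hk, hli, hspan⟩ := exists_fin_basis_of_span_range_eq_top hm _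
    (span_range_defectMap_eq_top A hL hz P hP)
  have hsum (c : Fin m → ℂ) : defectMap A z (∑ i, c i • ((P (k i) : H), L (P (k i)))) =
      ∑ i, c i • defectMap A z ((P (k i) : H), L (P (k i))) := by simp only [map_sum, map_smul]
  have hmem (c : Fin m → ℂ) : ∑ i, c i • ((P (k i) : H), L (P (k i))) ∈ L.graph :=
    Submodule.sum_smul_mem _ _ fun i _ => L.mem_graph _
  have hfst (c : Fin m → ℂ) : (∑ i, c i • ((P (k i) : H), L (P (k i)))).1 =
      ∑ i, c i • (P (k i) : H) := Prod.fst_sum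
  refine ⟨k, hk, fun c hc => ?_, fun f hf => ?_⟩
  · rw [← hfst, ← defectMap_eq_zero_iff hL hAL hA hz (hmem c), hsum] at hc
    exact Fintype.linearIndependent_iff.1 hli c hc
  · obtain ⟨c, hc⟩ := (Submodule.mem_span_range_iff_exists_fun ℂ).1
      (hspan.ge (Submodule.mem_top (x := defectMap A z (f, L ⟨f, hf⟩))))
    have hdiff := L.graph.sub_mem (L.mem_graph ⟨f, hf⟩) (hmem c)
    have hA' : f - ∑ i, c i • (P (k i) : H) ∈ A.domain := by
      rw [← hfst]
      refine (defectMap_eq_zero_iff hL hAL hA hz hdiff).1 ?_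
      rw [map_sub, hsum, sub_eq_zero]
      exact hc.symm
    rw [← sub_add_cancel f (∑ i, c i • (P (k i) : H))]
    exact Submodule.add_mem_sup hA'
      (Submodule.sum_smul_mem _ _ fun i _ => Submodule.subset_span ⟨i, rfl⟩)

end DefectMap

section BoundaryForm

/-- The boundary form `[f, g] = ⟪g, M f⟫ - ⟪M g, f⟫` of an operator `M` on its domain, linear in
`f` and conjugate-linear in `g`. -/
noncomputable def boundaryForm (M : H →ₗ.[ℂ] H) : M.domain →ₗ[ℂ] M.domain →ₗ⋆[ℂ] ℂ :=
  ((innerₛₗ ℂ).comp M.domain.subtype).flip ∘ₗ M.toFun -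
    ((innerₛₗ ℂ).comp M.toFun).flip ∘ₗ M.domain.subtype

theorem boundaryForm_apply (M : H →ₗ.[ℂ] H) (f g : M.domain) :
    boundaryForm M f g = inner ℂ (g : H) (M f) - inner ℂ (M g) (f : H) := rfl

theorem boundaryForm_eq_zero_iff {f g : M.domain} :
    boundaryForm M f g = 0 ↔ inner ℂ (M g) (f : H) = inner ℂ (g : H) (M f) := by
  rw [boundaryForm_apply, sub_eq_zero, eq_comm]

theorem boundaryForm_eq_zero_comm {f g : M.domain} :
    boundaryForm M f g = 0 ↔ boundaryForm M g f = 0 := by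
  rw [boundaryForm_eq_zero_iff, boundaryForm_eq_zero_iff, ← inner_conj_symm,
    ← inner_conj_symm _ (M f), (starRingEnd ℂ).injective.eq_iff, eq_comm]

variable [CompleteSpace H]

theorem mem_adjoint_domain_iff_boundaryForm_eq_zero (hM : Dense (M.domain : Set H))
    (hadj : M.adjoint ≤ M) {f : M.domain} :
    (f : H) ∈ M.adjoint.domain ↔ ∀ g, boundaryForm M f g = 0 := by
  simp only [boundaryForm_eq_zero_iff]
  constructor
  · intro hf g
    rw [← hadj.2 (x := ⟨f, hf⟩) rfl]
    exact (LinearPMap.adjoint_isFormalAdjoint hM).symm g ⟨f, hf⟩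
  · intro hf
    refine LinearPMap.mem_adjoint_domain_of_exists _ ⟨M f, fun g => ?_⟩
    rw [← inner_conj_symm, ← hf g, inner_conj_symm]

theorem mem_domain_iff_boundaryForm_eq_zero (hL : IsSelfAdjoint L) (hLM : L ≤ M) {f : M.domain} :
    (f : H) ∈ L.domain ↔ ∀ g : M.domain, (g : H) ∈ L.domain → boundaryForm M f g = 0 := by
  simp only [boundaryForm_eq_zero_iff]
  constructor
  · intro hf g hg
    rw [← hLM.2 (x := ⟨f, hf⟩) rfl, ← hLM.2 (x := ⟨g, hg⟩) rfl]
    exact isFormalAdjoint_of_isSelfAdjoint hL ⟨g, hg⟩ ⟨f, hf⟩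
  · intro hf
    rw [← LinearPMap.isSelfAdjoint_def.1 hL]
    refine LinearPMap.mem_adjoint_domain_of_exists _ ⟨M f, fun g => ?_⟩
    rw [hLM.2 (y := ⟨g, hLM.1 g.2⟩) rfl, ← inner_conj_symm, ← hf ⟨g, hLM.1 g.2⟩ g.2,
      inner_conj_symm]

theorem adjoint_le_of_isSelfAdjoint_of_le (hL : IsSelfAdjoint L) (hLM : L ≤ M) : M.adjoint ≤ L :=
  (adjoint_le_adjoint_of_le hL.dense_domain hLM).trans_eq (LinearPMap.isSelfAdjoint_def.1 hL)

theorem exists_boundary_conditions_of_hasCore {ι : Type*} (hL : IsSelfAdjoint L) (hLM : L ≤ M)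
    (hz : z.im ≠ 0) {m : ℕ} (hm : Module.rank ℂ (defectSpace M.adjoint z) = m) (P : ι → L.domain)
    (hP : L.HasCore (Submodule.span ℂ (Set.range fun k => (P k : H)))) :
    ∃ k : Fin m → ι, Function.Injective k ∧
      LinIndepModulo M.adjoint.domain (fun i => (P (k i) : H)) ∧
      ∀ f : M.domain, (f : H) ∈ L.domain ↔
        ∀ i, boundaryForm M f ⟨P (k i), hLM.1 (P (k i)).2⟩ = 0 := by
  have hM : Dense (M.domain : Set H) := hL.dense_domain.mono hLM.1
  have hadj : M.adjoint ≤ L := adjoint_le_of_isSelfAdjoint_of_le hL hLM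
  obtain ⟨k, hk, hli, hsup⟩ := exists_fin_basis_modulo_of_hasCore hL hadj
    (LinearPMap.adjoint_isClosed hM) hz hm P hP
  refine ⟨k, hk, hli, fun f => ⟨fun hf i => ?_, fun hf => ?_⟩⟩
  · exact (mem_domain_iff_boundaryForm_eq_zero hL hLM).1 hf _ (P (k i)).2
  have hker : M.adjoint.domain ⊔ Submodule.span ℂ (Set.range fun i => (P (k i) : H)) ≤
      (LinearMap.ker (boundaryForm M f)).map M.domain.subtype := by
    refine sup_le (fun u hu => ⟨⟨u, hLM.1 (hadj.1 hu)⟩, ?_, rfl⟩) (Submodule.span_le.2 ?_)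
    · exact boundaryForm_eq_zero_comm.1
        ((mem_adjoint_domain_iff_boundaryForm_eq_zero hM (hadj.trans hLM)).1 hu f)
    · rintro _ ⟨i, rfl⟩
      exact ⟨_, hf i, rfl⟩
  refine (mem_domain_iff_boundaryForm_eq_zero hL hLM).2 fun g hg => ?_
  obtain ⟨g', hg', hgg'⟩ := hker (hsup hg)
  rwa [← Subtype.ext hgg']

end BoundaryForm

section EndpointFilter

variable {a b : EReal}

/-- The filter of pairs `(α, β)` of reals with `α → a⁺` and `β → b⁻`. -/
noncomputable abbrev endpointFilter (a b : EReal) : Filter (ℝ × ℝ) :=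
  comap Real.toEReal (𝓝[>] a) ×ˢ comap Real.toEReal (𝓝[<] b)

theorem comap_nhdsGT_neBot (h : a < b) : (comap Real.toEReal (𝓝[>] a)).NeBot := by
  refine comap_neBot_iff.2 fun t ht => ?_
  obtain ⟨u, hu, hsub⟩ := (mem_nhdsGT_iff_exists_Ioo_subset' h).1 ht
  obtain ⟨x, hx⟩ := EReal.lt_iff_exists_real_btwn.1 hu
  exact ⟨x, hsub hx⟩

theorem comap_nhdsLT_neBot (h : a < b) : (comap Real.toEReal (𝓝[<] b)).NeBot := by
  refine comap_neBot_iff.2 fun t ht => ?_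
  obtain ⟨u, hu, hsub⟩ := (mem_nhdsLT_iff_exists_Ioo_subset' h).1 ht
  obtain ⟨x, hx⟩ := EReal.lt_iff_exists_real_btwn.1 hu
  exact ⟨x, hsub hx⟩

theorem endpointFilter_neBot (h : a < b) : (endpointFilter a b).NeBot :=
  prod_neBot.2 ⟨comap_nhdsGT_neBot h, comap_nhdsLT_neBot h⟩

theorem eventually_endpointFilter_mem_Ioo {x : ℝ} (hx : x ∈ interval a b) :
    ∀ᶠ t in endpointFilter a b, x ∈ Set.Ioo t.1 t.2 := by
  have hleft : ∀ᶠ α : ℝ in comap Real.toEReal (𝓝[>] a), (α : EReal) < x :=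
    (eventually_nhdsWithin_of_eventually_nhds (eventually_lt_nhds hx.1)).comap _
  have hright : ∀ᶠ β : ℝ in comap Real.toEReal (𝓝[<] b), (x : EReal) < β :=
    (eventually_nhdsWithin_of_eventually_nhds (eventually_gt_nhds hx.2)).comap _
  filter_upwards [hleft.prod_mk hright] with t ht
  exact ⟨EReal.coe_lt_coe_iff.1 ht.1, EReal.coe_lt_coe_iff.1 ht.2⟩

theorem tendsto_intervalIntegral_endpointFilter {E : Type*} [NormedAddCommGroup E]
    [NormedSpace ℝ E] {μ : Measure ℝ} (hab : a < b) (hμ : ∀ᵐ x ∂μ, x ∈ interval a b) {f : ℝ → E}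
    (hf : Integrable f μ) :
    Tendsto (fun t : ℝ × ℝ => ∫ x in t.1..t.2, f x ∂μ) (endpointFilter a b)
      (𝓝 (∫ x, f x ∂μ)) := by
  have hcover : AECover μ (endpointFilter a b) (fun t => Set.Ioc t.1 t.2) := by
    refine ⟨?_, fun _ => measurableSet_Ioc⟩
    filter_upwards [hμ] with x hx
    exact (eventually_endpointFilter_mem_Ioo hx).mono fun _ ht => Set.Ioo_subset_Ioc_self ht
  obtain ⟨c, hc⟩ := EReal.lt_iff_exists_real_btwn.1 hab
  refine (hcover.integral_tendsto_of_countably_generated hf).congr' ?_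
  filter_upwards [eventually_endpointFilter_mem_Ioo hc] with t ht
  exact (intervalIntegral.integral_of_le (ht.1.trans ht.2).le).symm

end EndpointFilter

namespace SymmExpr

variable {N : ℕ} {τ : SymmExpr N} {n : ℕ}

theorem ae_weightMeasure_mem_interval : ∀ᵐ x ∂τ.weightMeasure, x ∈ interval τ.a τ.b :=
  (withDensity_absolutelyContinuous _ _).ae_le
    (ae_restrict_mem (isOpen_interval _ _).measurableSet)

theorem hasBoundaryForm_boundaryForm (f g : (τ.maxOp n).domain) :
    HasBoundaryForm f g (boundaryForm (τ.maxOp n) f g) := by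
  have hgreen : ∫ x, ((τ.maxOp n f : τ.Space) x * (starRingEnd ℂ) ((g : τ.Space) x)
      - (starRingEnd ℂ) ((τ.maxOp n g : τ.Space) x) * (f : τ.Space) x) ∂τ.weightMeasure =
      boundaryForm (τ.maxOp n) f g := by
    rw [integral_sub (integrable_mul_conj _ _)
      (by simpa only [mul_comm] using integrable_mul_conj (f : τ.Space) (τ.maxOp n g)),
      boundaryForm_apply, L2.inner_def, L2.inner_def]
    simp only [RCLike.inner_apply, mul_comm]
  rw [← hgreen]
  exact tendsto_intervalIntegral_endpointFilter τ.a_lt_b ae_weightMeasure_mem_interval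
    (integrable_green f g)

theorem hasBoundaryForm_iff {f g : (τ.maxOp n).domain} {c : ℂ} :
    HasBoundaryForm f g c ↔ boundaryForm (τ.maxOp n) f g = c := by
  have := endpointFilter_neBot τ.a_lt_b
  refine ⟨fun h => tendsto_nhds_unique (hasBoundaryForm_boundaryForm f g) h, ?_⟩
  rintro rfl
  exact hasBoundaryForm_boundaryForm f g

theorem mem_minDomain_iff {f : (τ.maxOp n).domain} :
    (f : τ.Space) ∈ τ.minDomain n ↔ ∀ g, boundaryForm (τ.maxOp n) f g = 0 := by
  simp only [← hasBoundaryForm_iff]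
  refine ⟨?_, fun h => ⟨f, h, rfl⟩⟩
  rintro ⟨f', hf', h⟩
  rwa [← Subtype.ext h]

theorem minDomain_eq_adjoint_domain (hM : Dense ((τ.maxOp n).domain : Set τ.Space))
    (hadj : (τ.maxOp n).adjoint ≤ τ.maxOp n) :
    τ.minDomain n = (τ.maxOp n).adjoint.domain := by
  have hmem (f : (τ.maxOp n).domain) :
      (f : τ.Space) ∈ τ.minDomain n ↔ (f : τ.Space) ∈ (τ.maxOp n).adjoint.domain :=
    mem_minDomain_iff.trans (mem_adjoint_domain_iff_boundaryForm_eq_zero hM hadj).symm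
  ext f
  refine ⟨fun hf => (hmem ⟨f, ?_⟩).1 hf, fun hf => (hmem ⟨f, hadj.1 hf⟩).2 hf⟩
  exact Submodule.map_subtype_le _ _ hf

theorem minOp_eq_adjoint (hM : Dense ((τ.maxOp n).domain : Set τ.Space))
    (hadj : (τ.maxOp n).adjoint ≤ τ.maxOp n) : τ.minOp n = (τ.maxOp n).adjoint := by
  rw [minOp, minDomain_eq_adjoint_domain hM hadj]
  have hdom : ((τ.maxOp n).domRestrict (τ.maxOp n).adjoint.domain).domain =
      (τ.maxOp n).adjoint.domain := inf_eq_left.2 hadj.1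
  exact LinearPMap.ext hdom fun f hf hf' => (hadj.2 rfl).symm

end SymmExpr

end GKN

theorem theorem5p1_general {N : ℕ} (τ : GKN.SymmExpr N) (n : ℕ) {L : τ.Space →ₗ.[ℂ] τ.Space}
    (hL : IsSelfAdjoint L) (hmax : L ≤ τ.maxOp n) {z : ℂ} (hz : z.im ≠ 0) {m : ℕ}
    (hm : Module.rank ℂ (GKN.defectSpace (τ.minOp n) z) = m) {ι : Type*}
    (P : ι → (τ.maxOp n).domain)
    (hP : L.HasCore (Submodule.span ℂ (Set.range fun k => (P k : τ.Space)))) :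
    ∃ k : Fin m → ι, Function.Injective k ∧
      GKN.LinIndepModulo (τ.minDomain n) (fun i => (P (k i) : τ.Space)) ∧
      (∀ i j, GKN.SymmExpr.HasBoundaryForm (P (k i)) (P (k j)) 0) ∧
      (L.domain : Set τ.Space) =
        {f | ∃ hf : f ∈ (τ.maxOp n).domain,
          ∀ i, GKN.SymmExpr.HasBoundaryForm ⟨f, hf⟩ (P (k i)) 0} := by
  have hM : Dense ((τ.maxOp n).domain : Set τ.Space) := hL.dense_domain.mono hmax.1
  have hadj := (GKN.adjoint_le_of_isSelfAdjoint_of_le hL hmax).trans hmax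
  have hPL (k) : (P k : τ.Space) ∈ L.domain := hP.le_domain (Submodule.subset_span ⟨k, rfl⟩)
  rw [GKN.SymmExpr.minOp_eq_adjoint hM hadj] at hm
  obtain ⟨k, hk, hli, hdom⟩ :=
    GKN.exists_boundary_conditions_of_hasCore hL hmax hz hm (fun j => ⟨P j, hPL j⟩) hP
  simp only [GKN.SymmExpr.hasBoundaryForm_iff, GKN.SymmExpr.minDomain_eq_adjoint_domain hM hadj]
  refine ⟨k, hk, hli, fun i => (hdom (P (k i))).1 (hPL (k i)), Set.ext fun f => ⟨fun hf => ?_, ?_⟩⟩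
  · exact ⟨hmax.1 hf, (hdom ⟨f, hmax.1 hf⟩).1 hf⟩
  · rintro ⟨hf, hfk⟩
    exact (hdom ⟨f, hf⟩).2 hfk

theorem theorem5p1 {N : ℕ} (hN : 1 ≤ N) (τ : GKN.SymmExpr N) (n : ℕ) (hn : 1 ≤ n)
    (L : τ.Space →ₗ.[ℂ] τ.Space) (hL : IsSelfAdjoint L)
    (hmax : L ≤ τ.maxOp n) (hmin : τ.minOp n ≤ L)
    (m : ℕ) (hm : GKN.HasDeficiencyIndices (τ.minOp n) m)
    (P : ℕ → (τ.maxOp n).domain)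
    (hPL : ∀ k, (P k : τ.Space) ∈ L.domain)
    (hP0 : ∀ k, (P k : τ.Space) ≠ 0)
    (hPeig : ∀ k, ∃ lam : ℂ, L ⟨P k, hPL k⟩ = lam • (P k : τ.Space))
    (hPorth : ∀ j k, j ≠ k → inner ℂ (P j : τ.Space) (P k : τ.Space) = 0)
    (hPcomplete : Dense
      (Submodule.span ℂ (Set.range fun k => (P k : τ.Space)) : Set τ.Space)) :
    ∃ k : Fin m → ℕ, Function.Injective k ∧
      GKN.LinIndepModulo (τ.minDomain n) (fun i => (P (k i) : τ.Space)) ∧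
      (∀ i j, GKN.SymmExpr.HasBoundaryForm (P (k i)) (P (k j)) 0) ∧
      (L.domain : Set τ.Space) =
        {f | ∃ hf : f ∈ (τ.maxOp n).domain,
          ∀ i, GKN.SymmExpr.HasBoundaryForm ⟨f, hf⟩ (P (k i)) 0} := by
  exact theorem5p1_general τ n hL hmax (z := Complex.I) (by simp) hm.1 P
    (GKN.hasCore_span_eigenvectors hL (fun k => ⟨P k, hPL k⟩) hP0 hPeig hPcomplete)
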